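/- For $n\ge 2$ and a permutation $\pi\in\mathfrak S_n$ of $\{1,\dots,n\}$, let $\mathrm{mj}(\pi)=\min_{1\le i\le n-1}|\pi(i+1)-\pi(i)|$ be the minimum jump of $\pi$, and let $\mathbf Z_n$ be the random variable $\mathrm{mj}(\pi)$, where $\pi\in\mathfrak S_n$ is chosen uniformly at random. Let $\mathbf Z$ be an integer-valued random variable such that $\Pr[\mathbf Z\ge d+1]=e^{-2d}$ for every integer $d\ge 0$. Then for every fixed non-negative integer $a$, the $a$-th moment of $\mathbf Z$ is finite and $$\lim_{n\to\infty}\mathbb E[\mathbf Z_n^a]=\mathbb E[\mathbf Z^a].$$ In particular, $$\lim_{n\to\infty}\mathbb E[\mathbf Z_n]=\sum_{d=0}^{\infty}e^{-2d}\approx 1.1565176427496656518,$$ where the series converges and the decimal value is correct to within $\tfrac12\cdot 10^{-19}$. -/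

import Mathlib

open MeasureTheory ProbabilityTheory Filter Topology

/-- The minimum jump of a permutation of `{0, …, n-1}`: the least value of `|π(i+1) - π(i)|` over
all pairs of consecutive positions (for `n ≤ 1` there are none, and the value is `0`). -/
noncomputable def minJump {n : ℕ} (π : Equiv.Perm (Fin n)) : ℕ :=
  sInf {m : ℕ | ∃ i j : Fin n, (j : ℕ) = (i : ℕ) + 1 ∧
    m = (((π j : ℕ) : ℤ) - ((π i : ℕ) : ℤ)).natAbs}

/-- The `a`-th moment of the minimum jump of a uniformly random permutation of `n` points, that is,
the average of `minJump π ^ a` over all `n!` permutations. -/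
noncomputable def minJumpMoment (n a : ℕ) : ℝ :=
  Finset.expect (Finset.univ : Finset (Equiv.Perm (Fin n))) (fun π => (minJump π : ℝ) ^ a)

/-- `Z` is an integer-valued random variable on the probability space `(Ω, μ)` with
`Pr[Z ≥ d + 1] = exp (-2 d)` for every non-negative integer `d`. -/
structure IsJumpLimit {Ω : Type*} [MeasurableSpace Ω] (μ : Measure Ω) (Z : Ω → ℤ) : Prop where
  isProbabilityMeasure : IsProbabilityMeasure μ
  measurable : Measurable Z
  tail : ∀ d : ℕ, μ.real {ω | (d : ℤ) + 1 ≤ Z ω} = Real.exp (-2 * (d : ℝ))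

/-- Such a random variable exists. -/
theorem exists_isJumpLimit :
    ∃ (μ : Measure ℕ) (Z : ℕ → ℤ), IsJumpLimit μ Z := by
  have h1 : Real.exp (-2) < 1 := by
    rw [Real.exp_lt_one_iff]; norm_num
  let p : unitInterval := ⟨1 - Real.exp (-2), by linarith, by linarith [Real.exp_pos (-2)]⟩
  have hp : p ≠ 0 := by
    intro h
    have h' := congrArg Subtype.val h
    simp only [p, Set.Icc.coe_zero] at h'
    linarith
  refine ⟨geometricMeasure p, fun k => (k : ℤ) + 1, inferInstance, measurable_from_top, ?_⟩
  intro d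
  simp only [add_le_add_iff_right, Nat.cast_le]
  induction d with
  | zero => simp
  | succ d ih =>
    have hu : {k : ℕ | d ≤ k} = {d} ∪ {k : ℕ | d + 1 ≤ k} := by
      ext k; simp only [Set.mem_ofPred_eq, Set.mem_union, Set.mem_singleton_iff]; omega
    have hd : Disjoint ({d} : Set ℕ) {k : ℕ | d + 1 ≤ k} := by
      rw [Set.disjoint_singleton_left]; simp
    rw [hu, measureReal_union hd (MeasurableSet.of_discrete),
      geometricMeasure_real_singleton hp] at ih
    have hq : (1 - (p : ℝ)) = Real.exp (-2) := by simp [p]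
    have hq' : (p : ℝ) = 1 - Real.exp (-2) := rfl
    have e1 : Real.exp (-2 * (d : ℝ)) = Real.exp (-2) ^ d := by
      rw [← Real.exp_nat_mul]; ring_nf
    have e2 : Real.exp (-2 * ((d + 1 : ℕ) : ℝ)) = Real.exp (-2) ^ (d + 1) := by
      rw [← Real.exp_nat_mul]; ring_nf
    rw [e2]
    rw [hq, hq', e1] at ih
    rw [pow_succ]
    linarith

/-! Summation by parts gives `E[Z_n ^ a] = 0 ^ a + ∑ d, ((d + 1) ^ a - d ^ a) * P(Z_n ≥ d + 1)`, and
the same identity holds for `Z`. It therefore suffices that each tail converges to `exp (-2 d)` and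
that the tails are dominated uniformly in `n`.

Convergence. The event is that the number `X` of jumps of size at most `d` vanishes, and `X` is
asymptotically Poisson with mean `2 d`. Each binomial moment tends to `(2 d) ^ k / k!`
(`tendsto_binomialMoment`): a prescribed set of `k` positions has small jumps with probability at
most about `(2 d / n) ^ k`, and for pairwise non-consecutive positions this is also asymptotically a
lower bound. Bonferroni's inequalities then give `P(X = 0) → exp (-2 d)`
(`tendsto_noSmallJumpProb`).

Domination. The disjoint pairs of positions `(0, 1), (2, 3), …` are revealed in turn. By pigeonhole,
each of the first `n / 4` or so pairs is near with conditional probability of order at least `d /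
n`, so the tail is at most `exp (-(d - 3) / 32)` (`noSmallJumpProb_le_exp`).

All conditional probabilities are computed by one device: a set of permutations stable under
exchanging the images of certain points makes those images exchangeable
(`card_mul_sum_eq_sum_sum_of_swap`). -/

namespace MinJump

open Finset

/-! ### Near points, and averaging over transpositions -/

/-- Two elements of `Fin n` at distance at most `d`. -/
def Near {n : ℕ} (d : ℕ) (x y : Fin n) : Prop := (x : ℕ) ≤ y + d ∧ (y : ℕ) ≤ x + d

instance {n : ℕ} (d : ℕ) (x y : Fin n) : Decidable (Near d x y) :=
  inferInstanceAs (Decidable (_ ∧ _))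

theorem Near.symm {n d : ℕ} {x y : Fin n} (h : Near d x y) : Near d y x := ⟨h.2, h.1⟩

theorem card_near_ne_le {n : ℕ} (d : ℕ) (x : Fin n) :
    #{y : Fin n | y ≠ x ∧ Near d x y} ≤ 2 * d := by
  have h : (univ.filter fun y : Fin n => y ≠ x ∧ Near d x y).image (fun y : Fin n => (y : ℕ)) ⊆
      (Icc ((x : ℕ) - d) (x + d)).erase x := by
    intro t
    simp only [mem_image, mem_filter, mem_univ, true_and, mem_erase, mem_Icc]
    rintro ⟨y, ⟨h1, h2, h3⟩, rfl⟩
    have : (y : ℕ) ≠ x := fun h => h1 (Fin.ext h)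
    omega
  have h2 := card_le_card h
  rw [card_image_of_injective _ Fin.val_injective, card_erase_of_mem (by simp),
    Nat.card_Icc] at h2
  omega

theorem le_card_near_ne {n : ℕ} (d : ℕ) (x : Fin n) (h1 : d ≤ x) (h2 : (x : ℕ) + d < n) :
    2 * d ≤ #{y : Fin n | y ≠ x ∧ Near d x y} := by
  have h : (Icc ((x : ℕ) - d) (x + d)).erase x ⊆
      (univ.filter fun y : Fin n => y ≠ x ∧ Near d x y).image (fun y : Fin n => (y : ℕ)) := by
    intro t
    simp only [mem_image, mem_filter, mem_univ, true_and, mem_erase, mem_Icc]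
    rintro ⟨h3, h4, h5⟩
    refine ⟨⟨t, by omega⟩, ⟨fun h => h3 (by simp [← h]), ?_⟩, rfl⟩
    constructor <;> simp only <;> omega
  have h2 := card_le_card h
  rw [card_image_of_injective _ Fin.val_injective, card_erase_of_mem (by simp),
    Nat.card_Icc] at h2
  omega

theorem card_boundary_le {n : ℕ} (d : ℕ) :
    #{x : Fin n | ¬ (d ≤ (x : ℕ) ∧ (x : ℕ) + d < n)} ≤ 2 * d := by
  have h : (univ.filter fun x : Fin n => ¬ (d ≤ (x : ℕ) ∧ (x : ℕ) + d < n)).image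
      (fun y : Fin n => (y : ℕ)) ⊆ range d ∪ Ico (n - d) n := by
    intro t
    simp only [mem_image, mem_filter, mem_univ, true_and, mem_union, mem_range, mem_Ico]
    rintro ⟨y, h1, rfl⟩
    have := y.isLt
    omega
  have h2 := card_le_card h
  rw [card_image_of_injective _ Fin.val_injective] at h2
  have h3 := card_union_le (range d) (Ico (n - d) n)
  rw [Nat.card_Ico, card_range] at h3
  omega

/-- Averaging over the image of `b`: if a set `A` of permutations is stable under exchanging the
images of `b` and of any `p ∈ P`, then over `A` the image of `b` is distributed like the image of a
uniformly chosen element of `P`. -/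
theorem card_mul_sum_eq_sum_sum_of_swap {α : Type*} [Fintype α] [DecidableEq α]
    (A : Finset (Equiv.Perm α)) (P : Finset α) (b : α) (f : Equiv.Perm α → α → ℕ)
    (hA : ∀ p ∈ P, ∀ π ∈ A, π * Equiv.swap b p ∈ A)
    (hf : ∀ p ∈ P, ∀ π ∈ A, f (π * Equiv.swap b p) b = f π p) :
    #P * ∑ π ∈ A, f π b = ∑ π ∈ A, ∑ p ∈ P, f π p := by
  rw [sum_comm, ← smul_eq_mul, ← sum_const]
  refine sum_congr rfl fun p hp => ?_
  -- For fixed `p`, right multiplication by `swap b p` is an involution of `A` that turns the image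
  -- of `b` into that of `p`.
  refine sum_nbij' (fun π => π * Equiv.swap b p) (fun π => π * Equiv.swap b p)
    (hA p hp) (hA p hp) (fun π _ => by simp [mul_assoc]) (fun π _ => by simp [mul_assoc]) ?_
  intro π hπ
  rw [← hf p hp _ (hA p hp π hπ)]
  simp [mul_assoc]

theorem card_mul_card_filter_of_swap {α : Type*} [Fintype α] [DecidableEq α]
    (A : Finset (Equiv.Perm α)) (P : Finset α) (b : α) (f : Equiv.Perm α → α → Prop)
    [∀ π x, Decidable (f π x)]
    (hA : ∀ p ∈ P, ∀ π ∈ A, π * Equiv.swap b p ∈ A)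
    (hf : ∀ p ∈ P, ∀ π ∈ A, f (π * Equiv.swap b p) b ↔ f π p) :
    #P * #{π ∈ A | f π b} = ∑ π ∈ A, #{p ∈ P | f π p} := by
  have := card_mul_sum_eq_sum_sum_of_swap A P b (fun π x => if f π x then 1 else 0) hA
    (fun p hp π hπ => by simp only [hf p hp π hπ])
  simpa only [card_filter] using this

theorem card_filter_image_le {α : Type*} [Fintype α] [DecidableEq α]
    (π : Equiv.Perm α) (s : Finset α) (U : α → Prop) [DecidablePred U] :
    #{p ∈ s | U (π p)} ≤ #{x : α | U x} := by
  rw [← card_map π.toEmbedding]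
  refine card_le_card fun x => ?_
  simp only [mem_map_equiv, mem_filter, mem_univ, true_and]
  simp +contextual

/-! ### Sets of small jumps -/

variable {m : ℕ}

/-- The positions at which `π` has a jump of size at most `d`. -/
def smallJumps (d : ℕ) (π : Equiv.Perm (Fin (m + 1))) : Finset (Fin m) :=
  univ.filter fun i => Near d (π i.castSucc) (π i.succ)

/-- The permutations with jumps of size at most `d` at all positions of `S`. -/
def permsWith (d : ℕ) (S : Finset (Fin m)) : Finset (Equiv.Perm (Fin (m + 1))) :=
  univ.filter fun π => S ⊆ smallJumps d π

/-- The points whose images determine the jumps at the positions of `S`. -/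
def touched (S : Finset (Fin m)) : Finset (Fin (m + 1)) :=
  S.image Fin.castSucc ∪ S.image Fin.succ

theorem card_touched_le (S : Finset (Fin m)) : #(touched S) ≤ 2 * #S := by
  have h1 := card_union_le (S.image Fin.castSucc) (S.image Fin.succ)
  have h2 := card_image_le (s := S) (f := Fin.castSucc)
  have h3 := card_image_le (s := S) (f := Fin.succ)
  unfold touched
  omega

theorem castSucc_mem_touched {S : Finset (Fin m)} {i : Fin m} (h : i ∈ S) :
    i.castSucc ∈ touched S := mem_union_left _ (mem_image_of_mem _ h)

theorem succ_mem_touched {S : Finset (Fin m)} {i : Fin m} (h : i ∈ S) :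
    i.succ ∈ touched S := mem_union_right _ (mem_image_of_mem _ h)

theorem mem_permsWith {d : ℕ} {S : Finset (Fin m)} {π : Equiv.Perm (Fin (m + 1))} :
    π ∈ permsWith d S ↔ ∀ i ∈ S, Near d (π i.castSucc) (π i.succ) := by
  simp [permsWith, smallJumps, subset_iff]

theorem permsWith_empty (d : ℕ) : permsWith d (∅ : Finset (Fin m)) = univ := by
  ext; simp [mem_permsWith]

theorem permsWith_insert (d : ℕ) (S : Finset (Fin m)) (i : Fin m) :
    permsWith d (insert i S) =
      {π ∈ permsWith d S | Near d (π i.castSucc) (π i.succ)} := by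
  ext π
  simp only [mem_permsWith, mem_filter, forall_mem_insert]
  tauto

theorem mul_swap_mem_permsWith {d : ℕ} {S : Finset (Fin m)} {π : Equiv.Perm (Fin (m + 1))}
    {b p : Fin (m + 1)} (hb : b ∉ touched S) (hp : p ∉ touched S) (h : π ∈ permsWith d S) :
    π * Equiv.swap b p ∈ permsWith d S := by
  rw [mem_permsWith] at h ⊢
  intro i hi
  have key : ∀ x ∈ touched S, (π * Equiv.swap b p) x = π x := by
    intro x hx
    rw [Equiv.Perm.mul_apply, Equiv.swap_apply_of_ne_of_ne]
    · rintro rfl; exact hb hx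
    · rintro rfl; exact hp hx
  rw [key _ (castSucc_mem_touched hi), key _ (succ_mem_touched hi)]
  exact h i hi

/-- Given small jumps on `S`, the image of `i.succ` is uniform among the images of the untouched
points other than `i.castSucc`. The exact identity feeds both the upper and the lower bound;
`i.castSucc` itself may be touched. -/
theorem card_mul_card_permsWith_insert {d : ℕ} {S : Finset (Fin m)} {i : Fin m}
    (hb : i.succ ∉ touched S) :
    #(insert i.castSucc (touched S))ᶜ * #(permsWith d (insert i S)) =
      ∑ π ∈ permsWith d S, #{p ∈ (insert i.castSucc (touched S))ᶜ |
        Near d (π i.castSucc) (π p)} := by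
  rw [permsWith_insert]
  refine card_mul_card_filter_of_swap (permsWith d S) _ i.succ
    (fun π x => Near d (π i.castSucc) (π x)) ?_ ?_
  · intro p hp π hπ
    simp only [mem_compl, mem_insert, not_or] at hp
    exact mul_swap_mem_permsWith hb hp.2 hπ
  · intro p hp π hπ
    simp only [mem_compl, mem_insert, not_or] at hp
    have h1 : i.castSucc ≠ i.succ := Fin.castSucc_lt_succ.ne
    simp [Equiv.swap_apply_of_ne_of_ne h1 (Ne.symm hp.1)]

/-- A position beyond all of `S` has a fresh right endpoint even when it follows a position of `S`,
so consecutive positions need no separate treatment. At most `2 * d` values are near a given one. -/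
theorem card_permsWith_insert_le {d : ℕ} {S : Finset (Fin m)} {i : Fin m}
    (hi : ∀ j ∈ S, j < i) :
    (m + 1 - (2 * #S + 1)) * #(permsWith d (insert i S)) ≤ 2 * d * #(permsWith d S) := by
  have hb : i.succ ∉ touched S := by
    simp only [touched, mem_union, mem_image, not_or, not_exists, not_and]
    refine ⟨fun j hj h => ?_, fun j hj h => ?_⟩
    · have := hi j hj
      simp only [Fin.ext_iff, Fin.lt_def, Fin.val_castSucc, Fin.val_succ] at *
      omega
    · exact (hi j hj).ne (Fin.succ_injective _ h)
  have h1 : m + 1 - (2 * #S + 1) ≤ #(insert i.castSucc (touched S))ᶜ := by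
    rw [card_compl, Fintype.card_fin]
    have := card_insert_le i.castSucc (touched S)
    have := card_touched_le S
    omega
  refine (Nat.mul_le_mul_right _ h1).trans ?_
  rw [card_mul_card_permsWith_insert hb, mul_comm, ← smul_eq_mul, ← sum_const]
  refine sum_le_sum fun π _ => ?_
  refine le_trans ?_ (card_near_ne_le d (π i.castSucc))
  refine le_trans (card_le_card ?_)
    (card_filter_image_le π univ fun y => y ≠ π i.castSucc ∧ Near d (π i.castSucc) y)
  intro p
  simp only [mem_filter, mem_compl, mem_insert, mem_univ, true_and, not_or]
  rintro ⟨⟨h1, -⟩, h2⟩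
  exact ⟨fun h => h1 (π.injective h), h2⟩

theorem card_permsWith_le (d : ℕ) (S : Finset (Fin m)) :
    (m + 1 - 2 * #S) ^ #S * #(permsWith d S) ≤ (2 * d) ^ #S * (m + 1).factorial := by
  induction S using Finset.induction_on_max with
  | empty => simp [permsWith_empty, Fintype.card_perm]
  | insert i S hi ih =>
    have hiS : i ∉ S := fun h => (hi i h).false
    rw [card_insert_of_notMem hiS]
    calc (m + 1 - 2 * (#S + 1)) ^ (#S + 1) * #(permsWith d (insert i S))
        = (m + 1 - 2 * (#S + 1)) ^ #S *
            ((m + 1 - 2 * (#S + 1)) * #(permsWith d (insert i S))) := by ring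
      _ ≤ (m + 1 - 2 * #S) ^ #S *
            ((m + 1 - (2 * #S + 1)) * #(permsWith d (insert i S))) := by
          gcongr <;> omega
      _ ≤ (m + 1 - 2 * #S) ^ #S * (2 * d * #(permsWith d S)) := by
          exact Nat.mul_le_mul_left _ (card_permsWith_insert_le hi)
      _ = 2 * d * ((m + 1 - 2 * #S) ^ #S * #(permsWith d S)) := by ring
      _ ≤ 2 * d * ((2 * d) ^ #S * (m + 1).factorial) := by gcongr
      _ = _ := by ring

/-- The images of points outside `touched S` are seldom near the boundary. -/
theorem card_mul_card_boundary_le {d : ℕ} {S : Finset (Fin m)} {a : Fin (m + 1)}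
    (ha : a ∉ touched S) :
    #(touched S)ᶜ * #{π ∈ permsWith d S | ¬ (d ≤ (π a : ℕ) ∧ (π a : ℕ) + d < m + 1)} ≤
      2 * d * #(permsWith d S) := by
  rw [card_mul_card_filter_of_swap (permsWith d S) _ a
    (fun π x => ¬ (d ≤ (π x : ℕ) ∧ (π x : ℕ) + d < m + 1))
    (fun p hp π hπ => mul_swap_mem_permsWith ha (mem_compl.1 hp) hπ)
    (fun p hp π hπ => by simp), mul_comm, ← smul_eq_mul, ← sum_const]
  exact sum_le_sum fun π _ => (card_filter_image_le π _
    fun x : Fin (m + 1) => ¬ (d ≤ (x : ℕ) ∧ (x : ℕ) + d < m + 1)).trans (card_boundary_le d)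

/-- The images of two given points, one of them outside `touched S`, are seldom near. -/
theorem card_mul_card_near_le {d : ℕ} {S : Finset (Fin m)} {a p : Fin (m + 1)}
    (ha : a ∉ touched S) (hp : p ∈ touched S) :
    #(touched S)ᶜ * #{π ∈ permsWith d S | Near d (π a) (π p)} ≤ 2 * d * #(permsWith d S) := by
  rw [card_mul_card_filter_of_swap (permsWith d S) _ a (fun π x => Near d (π x) (π p))
    (fun q hq π hπ => mul_swap_mem_permsWith ha (mem_compl.1 hq) hπ)
    (fun q hq π hπ => ?_), mul_comm, ← smul_eq_mul, ← sum_const]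
  · refine sum_le_sum fun π _ => ?_
    refine le_trans ?_ (card_near_ne_le d (π p))
    refine le_trans (card_le_card ?_)
      (card_filter_image_le π univ fun y => y ≠ π p ∧ Near d (π p) y)
    intro q
    simp only [mem_filter, mem_compl, mem_univ, true_and]
    rintro ⟨h1, h2⟩
    refine ⟨fun h => h1 ?_, h2.symm⟩
    rwa [π.injective h]
  · have h1 : p ≠ a := by rintro rfl; exact ha hp
    have h2 : p ≠ q := by rintro rfl; exact (mem_compl.1 hq) hp
    simp [Equiv.swap_apply_of_ne_of_ne h1 h2]

/-- An interior value has `2 * d` near values. Losses arise when `π i.castSucc` lies near the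
boundary or when touched points occupy near values; as `i.castSucc` is untouched, its image can be
averaged, which makes both losses of order `1 / m`. -/
theorem le_card_permsWith_insert {d : ℕ} {S : Finset (Fin m)} {i : Fin m}
    (ha : i.castSucc ∉ touched S) (hb : i.succ ∉ touched S) :
    #(touched S)ᶜ * (2 * d) * #(permsWith d S) ≤
      #(touched S)ᶜ * ((m + 1) * #(permsWith d (insert i S))) +
        2 * d * (2 * d + 2 * #S) * #(permsWith d S) := by
  set a := i.castSucc
  -- The second term pays for a boundary value of `π a`, the third for near values taken by touched
  -- points.
  have h0 : ∀ π : Equiv.Perm (Fin (m + 1)), 2 * d ≤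
      #{p ∈ (insert a (touched S))ᶜ | Near d (π a) (π p)} +
      2 * d * (if ¬ (d ≤ (π a : ℕ) ∧ (π a : ℕ) + d < m + 1) then 1 else 0) +
      ∑ p ∈ touched S, if Near d (π a) (π p) then 1 else 0 := by
    intro π
    split_ifs with h
    · rw [← card_filter]
      refine (le_card_near_ne d (π a) h.1 h.2).trans ?_
      rw [mul_zero, add_zero]
      refine le_trans ?_ (card_union_le _ _)
      rw [← card_map π.symm.toEmbedding]
      refine card_le_card fun p => ?_
      simp only [mem_map_equiv, Equiv.symm_symm, mem_filter, mem_univ, true_and, mem_union,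
        mem_compl, mem_insert, not_or, ne_eq, EmbeddingLike.apply_eq_iff_eq]
      tauto
    · omega
  have h1 := sum_le_sum fun π (_ : π ∈ permsWith d S) => h0 π
  rw [sum_const, smul_eq_mul, sum_add_distrib, sum_add_distrib,
    ← card_mul_card_permsWith_insert hb, ← mul_sum, ← card_filter, sum_comm] at h1
  simp only [← card_filter] at h1
  have h2 := card_mul_card_boundary_le (d := d) ha
  have h3 : #(touched S)ᶜ * ∑ p ∈ touched S, #{π ∈ permsWith d S | Near d (π a) (π p)} ≤
      2 * #S * (2 * d * #(permsWith d S)) := by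
    rw [mul_sum]
    calc _ ≤ ∑ p ∈ touched S, 2 * d * #(permsWith d S) :=
          sum_le_sum fun p hp => card_mul_card_near_le ha hp
      _ = #(touched S) * (2 * d * #(permsWith d S)) := by rw [sum_const, smul_eq_mul]
      _ ≤ _ := Nat.mul_le_mul_right _ (card_touched_le S)
  have h4 : #(insert a (touched S))ᶜ ≤ m + 1 := by
    simpa using card_le_univ (insert a (touched S))ᶜ
  calc #(touched S)ᶜ * (2 * d) * #(permsWith d S)
      = #(touched S)ᶜ * (#(permsWith d S) * (2 * d)) := by ring
    _ ≤ #(touched S)ᶜ * _ := Nat.mul_le_mul_left _ h1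
    _ = #(touched S)ᶜ * (#(insert a (touched S))ᶜ * #(permsWith d (insert i S))) +
        2 * d * (#(touched S)ᶜ *
          #{π ∈ permsWith d S | ¬ (d ≤ (π a : ℕ) ∧ (π a : ℕ) + d < m + 1)}) +
        #(touched S)ᶜ * ∑ p ∈ touched S, #{π ∈ permsWith d S | Near d (π a) (π p)} := by ring
    _ ≤ #(touched S)ᶜ * ((m + 1) * #(permsWith d (insert i S))) +
        2 * d * (2 * d * #(permsWith d S)) + 2 * #S * (2 * d * #(permsWith d S)) := by
        gcongr
    _ = _ := by ring

end MinJump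

namespace MinJump

open Finset

/-! ### Factorial moments of the number of small jumps -/

/-- Double counting of the pairs `(π, S)` with `S ⊆ smallJumps d π` and `#S = k`. -/
theorem sum_choose_card_smallJumps (m d k : ℕ) :
    ∑ π : Equiv.Perm (Fin (m + 1)), (#(smallJumps d π)).choose k =
      ∑ S ∈ powersetCard k (univ : Finset (Fin m)), #(permsWith d S) := by
  have h := sum_card_bipartiteAbove_eq_sum_card_bipartiteBelow
    (fun (π : Equiv.Perm (Fin (m + 1))) (S : Finset (Fin m)) => S ⊆ smallJumps d π)
    (s := univ) (t := powersetCard k (univ : Finset (Fin m)))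
  refine Eq.trans (sum_congr rfl fun π _ => ?_) h
  rw [← card_powersetCard]
  congr 1
  ext S
  simp only [mem_powersetCard, mem_bipartiteAbove, subset_univ, true_and]
  tauto

/-- The sets of `k` positions no two of which are consecutive. -/
def separatedSets (m k : ℕ) : Finset (Finset (Fin m)) :=
  {S ∈ powersetCard k univ | ∀ i ∈ S, ∀ j ∈ S, i.succ ≠ j.castSucc}

/-- The positions that are neither in `S` nor next to an element of `S`. -/
def freePositions {m : ℕ} (S : Finset (Fin m)) : Finset (Fin m) :=
  {i | i.castSucc ∉ touched S ∧ i.succ ∉ touched S}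

/-- There are at most `2 * #S` touched points, and each rules out at most two positions. -/
theorem le_card_freePositions {m : ℕ} (S : Finset (Fin m)) :
    m ≤ #(freePositions S) + 4 * #S := by
  have h1 : #{i : Fin m | i.castSucc ∈ touched S} ≤ #(touched S) :=
    card_le_card_of_injOn Fin.castSucc (fun i hi => by simpa using hi)
      (Fin.castSucc_injective m).injOn
  have h2 : #{i : Fin m | i.succ ∈ touched S} ≤ #(touched S) :=
    card_le_card_of_injOn Fin.succ (fun i hi => by simpa using hi)
      (Fin.succ_injective m).injOn
  have h3 : (univ : Finset (Fin m)) ⊆ freePositions S ∪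
      (({i : Fin m | i.castSucc ∈ touched S} : Finset (Fin m)) ∪
        ({i : Fin m | i.succ ∈ touched S} : Finset (Fin m))) := by
    intro i _
    simp only [freePositions, mem_union, mem_filter, mem_univ, true_and]
    tauto
  have h4 := (card_le_card h3).trans (card_union_le _ _)
  have h5 := card_union_le (({i : Fin m | i.castSucc ∈ touched S} : Finset (Fin m)))
        ({i : Fin m | i.succ ∈ touched S} : Finset (Fin m))
  have h6 := card_touched_le S
  rw [card_univ, Fintype.card_fin] at h4
  omega

theorem not_mem_of_mem_freePositions {m : ℕ} {S : Finset (Fin m)} {i : Fin m}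
    (hi : i ∈ freePositions S) : i ∉ S := fun h => by
  simp only [freePositions, mem_filter] at hi
  exact hi.2.1 (castSucc_mem_touched h)

theorem insert_mem_separatedSets {m k : ℕ} {S : Finset (Fin m)} {i : Fin m}
    (hS : S ∈ separatedSets m k) (hi : i ∈ freePositions S) :
    insert i S ∈ separatedSets m (k + 1) := by
  have hiS := not_mem_of_mem_freePositions hi
  simp only [separatedSets, freePositions, mem_filter, mem_powersetCard, subset_univ, true_and,
    mem_univ] at hS hi ⊢
  refine ⟨by rw [card_insert_of_notMem hiS, hS.1], ?_⟩
  intro x hx y hy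
  rw [mem_insert] at hx hy
  rcases hx with rfl | hx <;> rcases hy with rfl | hy
  · exact Fin.castSucc_lt_succ.ne'
  · intro h; exact hi.2 (h ▸ castSucc_mem_touched hy)
  · intro h; exact hi.1 (h ▸ succ_mem_touched hx)
  · exact hS.2 x hx y hy

/-- The map `(S, i) ↦ (insert i S, i)` is injective into separated `(k + 1)`-sets with a marked
element, and each such set has `k + 1` markings. -/
theorem sum_freePositions_le {m : ℕ} (k : ℕ) (c : Finset (Fin m) → ℕ) :
    ∑ S ∈ separatedSets m k, ∑ i ∈ freePositions S, c (insert i S) ≤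
      (k + 1) * ∑ S ∈ separatedSets m (k + 1), c S := by
  have h : (k + 1) * ∑ S ∈ separatedSets m (k + 1), c S =
      ∑ S ∈ separatedSets m (k + 1), ∑ i ∈ S, c S := by
    rw [mul_sum]
    refine sum_congr rfl fun S hS => ?_
    simp only [separatedSets, mem_filter, mem_powersetCard] at hS
    rw [sum_const, smul_eq_mul, hS.1.2]
  rw [h, sum_sigma', sum_sigma']
  have hinj : Set.InjOn (fun x : (_ : Finset (Fin m)) × Fin m =>
      (⟨insert x.2 x.1, x.2⟩ : (_ : Finset (Fin m)) × Fin m))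
      ((separatedSets m k).sigma fun S => freePositions S) := by
    rintro ⟨S, i⟩ hx ⟨S', i'⟩ hy hxy
    simp only [coe_sigma, Set.mem_sigma_iff, mem_coe, Sigma.mk.injEq, heq_eq_eq] at hx hy hxy ⊢
    obtain ⟨h1, rfl⟩ := hxy
    refine ⟨?_, rfl⟩
    rw [← erase_insert (not_mem_of_mem_freePositions hx.2), h1,
      erase_insert (not_mem_of_mem_freePositions hy.2)]
  rw [← sum_image (f := fun x : (_ : Finset (Fin m)) × Fin m => c x.1) hinj]
  refine sum_le_sum_of_subset fun x hx => ?_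
  simp only [mem_image, mem_sigma] at hx ⊢
  obtain ⟨⟨S, i⟩, ⟨hS, hi⟩, rfl⟩ := hx
  exact ⟨insert_mem_separatedSets hS hi, mem_insert_self _ _⟩

/-- The `k`-th binomial moment of the number of jumps of size at most `d`. -/
noncomputable def binomialMoment (d k m : ℕ) : ℝ :=
  (∑ π : Equiv.Perm (Fin (m + 1)), (#(smallJumps d π)).choose k : ℕ) / (m + 1).factorial

/-- The part of the binomial moment that comes from separated sets of positions. -/
noncomputable def separatedMoment (d k m : ℕ) : ℝ :=
  (∑ S ∈ separatedSets m k, #(permsWith d S) : ℕ) / (m + 1).factorial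

theorem separatedMoment_le (d k m : ℕ) : separatedMoment d k m ≤ binomialMoment d k m := by
  unfold separatedMoment binomialMoment
  rw [sum_choose_card_smallJumps]
  gcongr
  exact filter_subset _ _

theorem separatedMoment_zero (d m : ℕ) : separatedMoment d 0 m = 1 := by
  unfold separatedMoment
  have : separatedSets m 0 = {∅} := by
    ext S
    simp only [separatedSets, mem_filter, mem_powersetCard, mem_singleton, card_eq_zero]
    constructor
    · rintro ⟨⟨-, h⟩, -⟩; exact h
    · rintro rfl; simp
  rw [this, sum_singleton, permsWith_empty, card_univ, Fintype.card_perm, Fintype.card_fin]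
  exact div_self (by positivity)

theorem binomialMoment_le {d k m : ℕ} (h : 2 * k < m + 1) :
    binomialMoment d k m ≤
      (2 * d : ℝ) ^ k / k.factorial * ((m : ℝ) / (m + 1 - 2 * k)) ^ k := by
  have hpos : (0 : ℝ) < m + 1 - 2 * k := by
    have : (2 * k : ℝ) < m + 1 := by exact_mod_cast h
    linarith
  unfold binomialMoment
  rw [sum_choose_card_smallJumps, div_le_iff₀ (by positivity)]
  have h1 : ∀ S ∈ powersetCard k (univ : Finset (Fin m)), (#(permsWith d S) : ℝ) ≤
      (2 * d : ℝ) ^ k * (m + 1).factorial / (m + 1 - 2 * k) ^ k := by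
    intro S hS
    rw [mem_powersetCard] at hS
    rw [le_div_iff₀ (by positivity)]
    have := card_permsWith_le d S
    rw [hS.2] at this
    have h2 : (((m + 1 - 2 * k : ℕ) : ℝ)) = m + 1 - 2 * k := by
      rw [Nat.cast_sub h.le]; push_cast; ring
    rw [← h2, mul_comm]
    exact_mod_cast this
  push_cast
  refine (sum_le_sum h1).trans ?_
  rw [sum_const, card_powersetCard, card_univ, Fintype.card_fin, nsmul_eq_mul]
  calc ((m.choose k : ℕ) : ℝ) * ((2 * d : ℝ) ^ k * (m + 1).factorial / (m + 1 - 2 * k) ^ k)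
      ≤ ((m : ℝ) ^ k / k.factorial) *
          ((2 * d : ℝ) ^ k * (m + 1).factorial / (m + 1 - 2 * k) ^ k) := by
        gcongr
        exact Nat.choose_le_pow_div k m
    _ = _ := by rw [div_pow]; field_simp

/-- The loss factor in the recursion for `separatedMoment`. -/
noncomputable def lossFactor (d k m : ℕ) : ℝ :=
  ((m : ℝ) - 4 * k) / (m + 1) * (1 - (2 * d + 2 * k) / (m + 1 - 2 * k))

/-- In `lossFactor`, the first factor bounds the share of free positions and the second the losses
of `le_card_permsWith_insert`; the hypothesis keeps both nonnegative. -/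
theorem le_separatedMoment_succ {d k m : ℕ} (h : 4 * k + 2 * d < m) :
    separatedMoment d k m * (2 * d * lossFactor d k m) ≤
      (k + 1) * separatedMoment d (k + 1) m := by
  have hR : (4 * k + 2 * d : ℝ) < m := by exact_mod_cast h
  have hm : (0 : ℝ) < m + 1 := by positivity
  have hq : (0 : ℝ) < m + 1 - 2 * k := by linarith [(Nat.cast_nonneg k : (0 : ℝ) ≤ k),
    (Nat.cast_nonneg d : (0 : ℝ) ≤ d)]
  set e : ℝ := 1 - (2 * d + 2 * k) / (m + 1 - 2 * k)
  have he : 0 ≤ e := by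
    rw [sub_nonneg, div_le_one hq]
    linarith
  have step : ∀ S ∈ separatedSets m k, (#(permsWith d S) : ℝ) * (2 * d * lossFactor d k m) ≤
      ∑ i ∈ freePositions S, (#(permsWith d (insert i S)) : ℝ) := by
    intro S hS
    have hSk : #S = k := by
      simp only [separatedSets, mem_filter, mem_powersetCard] at hS
      exact hS.1.2
    have hT : (m + 1 - 2 * k : ℝ) ≤ (#(touched S)ᶜ : ℝ) := by
      rw [sub_le_iff_le_add]
      have h1 := card_touched_le S
      have h2 := card_add_card_compl (touched S)
      rw [Fintype.card_fin] at h2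
      have : m + 1 ≤ #(touched S)ᶜ + 2 * k := by omega
      exact_mod_cast this
    have hTpos : (0 : ℝ) < (#(touched S)ᶜ : ℝ) := hq.trans_le hT
    have hone : ∀ i ∈ freePositions S, (#(permsWith d S) : ℝ) * (2 * d / (m + 1) * e) ≤
        (#(permsWith d (insert i S)) : ℝ) := by
      intro i hi
      simp only [freePositions, mem_filter] at hi
      have h1 : (#(touched S)ᶜ * (2 * d) * #(permsWith d S) : ℝ) ≤
          #(touched S)ᶜ * ((m + 1) * #(permsWith d (insert i S))) +
          2 * d * (2 * d + 2 * #S) * #(permsWith d S) := by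
        exact_mod_cast le_card_permsWith_insert (d := d) hi.2.1 hi.2.2
      rw [hSk] at h1
      have h2 : (2 * d + 2 * k : ℝ) ≤ (1 - e) * #(touched S)ᶜ := by
        have : (1 - e) = (2 * d + 2 * k) / (m + 1 - 2 * k) := by simp [e]
        rw [this, div_mul_eq_mul_div, le_div_iff₀ hq]
        gcongr
      have h3 : (#(touched S)ᶜ : ℝ) * (#(permsWith d S) * (2 * d) * e) ≤
          #(touched S)ᶜ * ((m + 1) * #(permsWith d (insert i S))) := by
        have h4 : (2 * d : ℝ) * (2 * d + 2 * k) * #(permsWith d S) ≤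
            2 * d * ((1 - e) * #(touched S)ᶜ) * #(permsWith d S) := by gcongr
        linarith
      have h5 := le_of_mul_le_mul_left h3 hTpos
      calc (#(permsWith d S) : ℝ) * (2 * d / (m + 1) * e)
          = #(permsWith d S) * (2 * d) * e / (m + 1) := by ring
        _ ≤ _ := by rw [div_le_iff₀ hm]; linarith
    refine le_trans ?_ (sum_le_sum hone)
    rw [sum_const, nsmul_eq_mul]
    have h6 : (m - 4 * k : ℝ) ≤ #(freePositions S) := by
      rw [sub_le_iff_le_add]
      have := le_card_freePositions S
      rw [hSk] at this
      exact_mod_cast this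
    calc (#(permsWith d S) : ℝ) * (2 * d * lossFactor d k m)
        = (m - 4 * k) * ((#(permsWith d S) : ℝ) * (2 * d / (m + 1) * e)) := by
          unfold lossFactor; ring
      _ ≤ _ := by gcongr
  unfold separatedMoment
  rw [div_mul_eq_mul_div, mul_div_assoc']
  refine div_le_div_of_nonneg_right ?_ (by positivity)
  have h7 : (∑ S ∈ separatedSets m k, ∑ i ∈ freePositions S,
      (#(permsWith d (insert i S)) : ℝ)) ≤
      (k + 1) * ∑ S ∈ separatedSets m (k + 1), (#(permsWith d S) : ℝ) := by
    exact_mod_cast sum_freePositions_le k fun S : Finset (Fin m) => #(permsWith d S)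
  push_cast
  rw [sum_mul]
  exact (sum_le_sum step).trans h7

/-! ### Limits of the binomial moments -/

theorem tendsto_const_div_add (a b : ℝ) :
    Tendsto (fun m : ℕ => a / ((m : ℝ) + b)) atTop (𝓝 0) :=
  (tendsto_natCast_atTop_atTop.atTop_add tendsto_const_nhds).const_div_atTop a

theorem tendsto_add_div_add (a b : ℝ) :
    Tendsto (fun m : ℕ => ((m : ℝ) + a) / ((m : ℝ) + b)) atTop (𝓝 1) := by
  have h := (tendsto_const_div_add (a - b) b).const_add 1
  rw [add_zero] at h
  refine h.congr' ?_
  have h2 : ∀ᶠ m : ℕ in atTop, 0 < (m : ℝ) + b :=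
    (tendsto_natCast_atTop_atTop.atTop_add tendsto_const_nhds).eventually_gt_atTop 0
  filter_upwards [h2] with m hm
  field_simp
  ring

theorem tendsto_lossFactor (d k : ℕ) : Tendsto (lossFactor d k) atTop (𝓝 1) := by
  have h1 := tendsto_add_div_add (-(4 * k)) 1
  have h2 := (tendsto_const_div_add (2 * d + 2 * k) (1 - 2 * k)).const_sub 1
  have h := h1.mul h2
  rw [sub_zero, mul_one] at h
  refine h.congr fun m => ?_
  unfold lossFactor
  ring_nf

theorem exists_tendsto_le_separatedMoment (d k : ℕ) :
    ∃ L : ℕ → ℝ, Tendsto L atTop (𝓝 ((2 * d : ℝ) ^ k / k.factorial)) ∧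
      ∀ᶠ m in atTop, L m ≤ separatedMoment d k m := by
  induction k with
  | zero => exact ⟨fun _ => 1, by simp, by simp [separatedMoment_zero]⟩
  | succ k ih =>
    obtain ⟨L, hL, hle⟩ := ih
    refine ⟨fun m => L m * (2 * d * lossFactor d k m) / (k + 1), ?_, ?_⟩
    · have h := (hL.mul ((tendsto_lossFactor d k).const_mul (2 * d : ℝ))).div_const (k + 1 : ℝ)
      convert h using 2
      rw [pow_succ, Nat.factorial_succ]
      push_cast
      field_simp
    · have hpos := (tendsto_lossFactor d k).eventually_const_le zero_lt_one
      filter_upwards [hle, hpos, eventually_gt_atTop (4 * k + 2 * d)] with m h1 h2 h3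
      rw [div_le_iff₀ (by positivity), mul_comm (separatedMoment _ _ _)]
      refine le_trans ?_ (le_separatedMoment_succ h3)
      gcongr

/-- The lower bound from separated sets and the upper bound from all sets have the same limit, so
non-separated sets never have to be estimated. -/
theorem tendsto_binomialMoment (d k : ℕ) :
    Tendsto (binomialMoment d k) atTop (𝓝 ((2 * d : ℝ) ^ k / k.factorial)) := by
  obtain ⟨L, hL, hle⟩ := exists_tendsto_le_separatedMoment d k
  have hU : Tendsto (fun m : ℕ => (2 * d : ℝ) ^ k / k.factorial *
      ((m : ℝ) / (m + 1 - 2 * k)) ^ k) atTop (𝓝 ((2 * d : ℝ) ^ k / k.factorial)) := by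
    have h := ((tendsto_add_div_add 0 (1 - 2 * k)).pow k).const_mul
      ((2 * d : ℝ) ^ k / k.factorial)
    rw [one_pow, mul_one] at h
    refine h.congr fun m => ?_
    ring_nf
  refine tendsto_of_tendsto_of_tendsto_of_le_of_le' hL hU ?_ ?_
  · filter_upwards [hle] with m hm using hm.trans (separatedMoment_le d k m)
  · filter_upwards [eventually_ge_atTop (2 * k)] with m hm using binomialMoment_le (by omega)

/-! ### The limiting tail probabilities -/

/-- Bonferroni: for `x, k ≥ 1` the partial alternating sum is `± (x - 1).choose (k - 1)`, which is
at most `x.choose k` by Pascal's rule. -/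
theorem abs_sub_alternating_sum_choose_le (x k : ℕ) :
    |(if x = 0 then (1 : ℝ) else 0) - ∑ j ∈ range k, (-1) ^ j * (x.choose j : ℝ)| ≤
      x.choose k := by
  rcases k with _ | k
  · split_ifs <;> simp
  rcases x with _ | x
  · rw [sum_range_succ']
    simp
  · have h : ∑ j ∈ range (k + 1), (-1) ^ j * ((x + 1).choose j : ℝ) = (-1) ^ k * x.choose k := by
      exact_mod_cast Int.alternating_sum_range_choose_eq_choose (n := x) (m := k)
    rw [h, if_neg (Nat.succ_ne_zero x), zero_sub, abs_neg, abs_mul, abs_pow, abs_neg, abs_one,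
      one_pow, one_mul, Nat.abs_cast, Nat.choose_succ_succ]
    push_cast
    linarith [(Nat.cast_nonneg (x.choose (k + 1)) : (0 : ℝ) ≤ _)]

/-- The probability that a random permutation of `m + 1` points has no jump of size at most `d`. -/
noncomputable def noSmallJumpProb (d m : ℕ) : ℝ :=
  #{π : Equiv.Perm (Fin (m + 1)) | smallJumps d π = ∅} / (m + 1).factorial

theorem abs_noSmallJumpProb_sub_le (d k m : ℕ) :
    |noSmallJumpProb d m - ∑ j ∈ range k, (-1) ^ j * binomialMoment d j m| ≤
      binomialMoment d k m := by
  have h : noSmallJumpProb d m - ∑ j ∈ range k, (-1) ^ j * binomialMoment d j m =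
      (∑ π : Equiv.Perm (Fin (m + 1)), ((if #(smallJumps d π) = 0 then (1 : ℝ) else 0) -
        ∑ j ∈ range k, (-1) ^ j * ((#(smallJumps d π)).choose j : ℝ))) / (m + 1).factorial := by
    rw [sum_sub_distrib, sub_div]
    congr 1
    · rw [noSmallJumpProb, card_filter]
      simp [card_eq_zero]
    · rw [sum_comm, sum_div]
      refine sum_congr rfl fun j _ => ?_
      rw [binomialMoment, ← mul_sum, mul_div_assoc]
      push_cast
      rfl
  rw [h, abs_div, Nat.abs_cast, binomialMoment]
  gcongr
  push_cast
  exact (abs_sum_le_sum_abs _ _).trans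
    (sum_le_sum fun π _ => abs_sub_alternating_sum_choose_le _ _)

theorem tendsto_noSmallJumpProb (d : ℕ) :
    Tendsto (noSmallJumpProb d) atTop (𝓝 (Real.exp (-2 * d))) := by
  have hsum : ∀ x : ℝ, HasSum (fun k : ℕ => x ^ k / k.factorial) (Real.exp x) := by
    intro x
    rw [Real.exp_eq_exp_ℝ]
    exact NormedSpace.expSeries_div_hasSum_exp x
  have h1 : Tendsto (fun k : ℕ => ∑ j ∈ range k, (-1 : ℝ) ^ j * ((2 * d : ℝ) ^ j / j.factorial))
      atTop (𝓝 (Real.exp (-2 * d))) := by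
    refine (hsum (-2 * d)).tendsto_sum_nat.congr fun k => sum_congr rfl fun j _ => ?_
    rw [mul_div_assoc', ← mul_pow]
    ring_nf
  have h2 : Tendsto (fun k : ℕ => (2 * d : ℝ) ^ k / k.factorial) atTop (𝓝 0) :=
    (hsum (2 * d)).summable.tendsto_atTop_zero
  rw [Metric.tendsto_atTop]
  intro ε hε
  have hε3 : 0 < ε / 4 := by positivity
  -- First `k` is fixed, then `m` grows. Of the four shares `ε / 4`, two bound the Bonferroni error
  -- `binomialMoment d k m`, one the truncation of the exponential series, one the convergence of
  -- the partial sum.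
  obtain ⟨k, hk1, hk2⟩ := ((Metric.tendsto_nhds.1 h1 _ hε3).and
    (Metric.tendsto_nhds.1 h2 _ hε3)).exists
  have h3 : Tendsto (fun m => ∑ j ∈ range k, (-1 : ℝ) ^ j * binomialMoment d j m) atTop
      (𝓝 (∑ j ∈ range k, (-1 : ℝ) ^ j * ((2 * d : ℝ) ^ j / j.factorial))) :=
    tendsto_finsetSum _ fun j _ => (tendsto_binomialMoment d j).const_mul _
  obtain ⟨N, hN⟩ := eventually_atTop.1 ((Metric.tendsto_nhds.1 h3 _ hε3).and
    (Metric.tendsto_nhds.1 (tendsto_binomialMoment d k) _ hε3))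
  refine ⟨N, fun m hm => ?_⟩
  obtain ⟨h4, h5⟩ := hN m hm
  have h6 := abs_noSmallJumpProb_sub_le d k m
  rw [Real.dist_eq, abs_lt] at *
  rw [abs_le] at h6
  constructor <;> linarith

end MinJump

namespace MinJump

open Finset

/-! ### A uniform exponential bound for the tail -/

/-- Averaging twice, over the image of `b` with that of `a` fixed and then over that of `a`, makes
the two images a uniform ordered pair of distinct images of points of `R`. -/
theorem card_mul_card_mul_card_filter_of_swap {α : Type*} [Fintype α] [DecidableEq α]
    (A : Finset (Equiv.Perm α)) (R : Finset α) {a b : α} (ha : a ∈ R) (hb : b ∈ R) (hab : a ≠ b)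
    (F : α → α → Prop) [∀ x y, Decidable (F x y)]
    (hA : ∀ p ∈ R, ∀ q ∈ R, ∀ π ∈ A, π * Equiv.swap p q ∈ A) :
    #R * (#(R.erase a) * #{π ∈ A | F (π a) (π b)}) =
      ∑ π ∈ A, ∑ p ∈ R, #{q ∈ R.erase p | F (π p) (π q)} := by
  rw [card_mul_card_filter_of_swap A (R.erase a) b (fun π x => F (π a) (π x))]
  · refine card_mul_sum_eq_sum_sum_of_swap A R a
      (fun π x => #{q ∈ R.erase x | F (π x) (π q)}) (fun p hp π hπ => hA a ha p hp π hπ) ?_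
    intro p hp π _
    refine card_equiv (Equiv.swap a p) fun q => ?_
    have h1 : Equiv.swap a p q ∈ R ↔ q ∈ R := by
      rw [Equiv.swap_apply_def]
      split_ifs with h h'
      · simp [h, ha, hp]
      · simp [h', ha, hp]
      · rfl
    have h2 : Equiv.swap a p q = p ↔ q = a := by
      rw [Equiv.swap_apply_eq_iff, Equiv.swap_apply_right]
    simp [h1, h2]
  · intro p hp π hπ
    exact hA b hb p (mem_of_mem_erase hp) π hπ
  · intro p hp π _
    simp [Equiv.swap_apply_of_ne_of_ne hab (ne_of_mem_erase hp).symm]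

/-- A set of points of `Fin n` has many pairs at distance at most `d`. -/
theorem sq_card_le_mul_sum_card_near {n : ℕ} (d : ℕ) (R : Finset (Fin n))
    (π : Equiv.Perm (Fin n)) :
    #R ^ 2 ≤ (n / (d + 1) + 1) * ∑ p ∈ R, #{q ∈ R | Near d (π p) (π q)} := by
  -- Values in a common block of length `d + 1` are near; Cauchy–Schwarz over the blocks bounds the
  -- number of such pairs, the diagonal included.
  set block : Fin n → ℕ := fun p => (π p : ℕ) / (d + 1)
  set B := range (n / (d + 1) + 1)
  have hmaps : ∀ p ∈ R, block p ∈ B := fun p _ => by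
    simp only [B, block, mem_range, Nat.lt_succ_iff]
    exact Nat.div_le_div_right (π p).isLt.le
  have h1 : #R = ∑ t ∈ B, #{p ∈ R | block p = t} := card_eq_sum_card_fiberwise hmaps
  have h2 : ∑ t ∈ B, #{p ∈ R | block p = t} ^ 2 ≤ ∑ p ∈ R, #{q ∈ R | Near d (π p) (π q)} := by
    rw [← sum_fiberwise_of_maps_to hmaps]
    refine sum_le_sum fun t _ => ?_
    rw [sq, ← smul_eq_mul, ← sum_const]
    refine sum_le_sum fun p hp => card_le_card fun q hq => ?_
    simp only [mem_filter, block] at hp hq ⊢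
    refine ⟨hq.1, ?_⟩
    have h3 := Nat.div_add_mod (π p : ℕ) (d + 1)
    have h4 := Nat.div_add_mod (π q : ℕ) (d + 1)
    have h5 := Nat.mod_lt (π p : ℕ) (by omega : 0 < d + 1)
    have h6 := Nat.mod_lt (π q : ℕ) (by omega : 0 < d + 1)
    rw [hp.2] at h3
    rw [hq.2] at h4
    constructor <;> omega
  calc #R ^ 2 = (∑ t ∈ B, #{p ∈ R | block p = t}) ^ 2 := by rw [← h1]
    _ ≤ #B * ∑ t ∈ B, #{p ∈ R | block p = t} ^ 2 := sq_sum_le_card_mul_sum_sq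
    _ ≤ _ := by
      rw [card_range]
      exact Nat.mul_le_mul_left _ h2

/-- The permutations for which the jumps at the positions `0, 2, …, 2 (j - 1)` all exceed `d`. -/
def farPairs (n d j : ℕ) : Finset (Equiv.Perm (Fin n)) :=
  {π | ∀ x y : Fin n, ∀ i < j, (x : ℕ) = 2 * i → (y : ℕ) = 2 * i + 1 → ¬ Near d (π x) (π y)}

theorem farPairs_succ {n d j : ℕ} (h : 2 * j + 1 < n) :
    farPairs n d (j + 1) =
      {π ∈ farPairs n d j | ¬ Near d (π ⟨2 * j, by omega⟩) (π ⟨2 * j + 1, h⟩)} := by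
  ext π
  simp only [farPairs, mem_filter, mem_univ, true_and]
  constructor
  · intro H
    exact ⟨fun x y i hi => H x y i (by omega), H _ _ j (by omega) rfl rfl⟩
  · rintro ⟨H1, H2⟩ x y i hi hx hy
    rcases Nat.lt_succ_iff_lt_or_eq.1 hi with hi | rfl
    · exact H1 x y i hi hx hy
    · have e1 : x = ⟨2 * i, by omega⟩ := Fin.ext hx
      have e2 : y = ⟨2 * i + 1, h⟩ := Fin.ext hy
      rw [e1, e2]
      exact H2

theorem card_farPairs_succ_le {n d j : ℕ} (hd : 3 ≤ d) (hdn : d + 1 ≤ n) (hj : 4 * (j + 1) ≤ n) :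
    (#(farPairs n d (j + 1)) : ℝ) ≤ (1 - (d - 3) / (4 * n)) * #(farPairs n d j) := by
  have hn : 2 * j + 1 < n := by omega
  -- Exchanging images within `R` leaves the earlier pairs alone, and `4 * (j + 1) ≤ n` ensures that
  -- `R` contains at least half of the points.
  set R : Finset (Fin n) := {p | 2 * j ≤ (p : ℕ)}
  have hR : #R = n - 2 * j := by
    have : R.map Fin.valEmbedding = Ico (2 * j) n := by
      ext t
      simp only [R, Finset.mem_map, mem_filter, mem_univ, true_and, Fin.valEmbedding_apply, mem_Ico]
      constructor
      · rintro ⟨p, hp, rfl⟩; exact ⟨hp, p.isLt⟩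
      · rintro ⟨h1, h2⟩; exact ⟨⟨t, h2⟩, h1, rfl⟩
    rw [← card_map, this, Nat.card_Ico]
  have ha : (⟨2 * j, by omega⟩ : Fin n) ∈ R := by simp [R]
  have hb : (⟨2 * j + 1, hn⟩ : Fin n) ∈ R := by simp [R]
  have key := card_mul_card_mul_card_filter_of_swap (farPairs n d j) R ha hb
    (by simp [Fin.ext_iff]) (fun x y => ¬ Near d x y) (by
      intro p hp q hq π hπ
      simp only [R, farPairs, mem_filter, mem_univ, true_and] at hp hq hπ ⊢
      intro x y i hi hx hy
      have e : ∀ z : Fin n, (z : ℕ) < 2 * j → (π * Equiv.swap p q) z = π z := by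
        intro z hz
        rw [Equiv.Perm.mul_apply, Equiv.swap_apply_of_ne_of_ne]
        · rintro rfl; omega
        · rintro rfl; omega
      rw [e x (by omega), e y (by omega)]
      exact hπ x y i hi hx hy)
  rw [← farPairs_succ hn, card_erase_of_mem ha] at key
  set r := #R
  set B := n / (d + 1) + 1
  have hr2 : 2 ≤ r := by omega
  have hrn : r ≤ n := by omega
  have hπ : ∀ π : Equiv.Perm (Fin n),
      (∑ p ∈ R, #{q ∈ R.erase p | ¬ Near d (π p) (π q)} : ℝ) ≤ r ^ 2 * (1 - 1 / B) := by
    intro π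
    have h1 : (∑ p ∈ R, #{q ∈ R.erase p | ¬ Near d (π p) (π q)}) +
        ∑ p ∈ R, #{q ∈ R | Near d (π p) (π q)} ≤ r ^ 2 := by
      rw [← sum_add_distrib, sq, ← smul_eq_mul, ← sum_const]
      refine sum_le_sum fun p _ => ?_
      change _ ≤ #R
      rw [add_comm, ← card_filter_add_card_filter_not (s := R) (fun q => Near d (π p) (π q))]
      gcongr
      exact erase_subset _ _
    have h2 := sq_card_le_mul_sum_card_near d R π
    have h1' : (∑ p ∈ R, #{q ∈ R.erase p | ¬ Near d (π p) (π q)} : ℝ) +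
        ∑ p ∈ R, (#{q ∈ R | Near d (π p) (π q)} : ℝ) ≤ (r : ℝ) ^ 2 := by exact_mod_cast h1
    have h2' : (r : ℝ) ^ 2 ≤ B * ∑ p ∈ R, (#{q ∈ R | Near d (π p) (π q)} : ℝ) := by
      exact_mod_cast h2
    have hB : (0 : ℝ) < B := by positivity
    have h3 : (r : ℝ) ^ 2 * (1 / B) ≤ ∑ p ∈ R, (#{q ∈ R | Near d (π p) (π q)} : ℝ) := by
      rw [mul_one_div, div_le_iff₀ hB]
      linarith
    linarith
  have h4 : (r : ℝ) * ((r - 1) * #(farPairs n d (j + 1))) ≤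
      #(farPairs n d j) * (r ^ 2 * (1 - 1 / B)) := by
    have h5 : (r : ℝ) * ((r - 1) * #(farPairs n d (j + 1))) =
        ∑ π ∈ farPairs n d j, ∑ p ∈ R, (#{q ∈ R.erase p | ¬ Near d (π p) (π q)} : ℝ) := by
      have : ((r - 1 : ℕ) : ℝ) = r - 1 := by rw [Nat.cast_sub (by omega)]; simp
      rw [← this]
      exact_mod_cast key
    rw [h5, ← nsmul_eq_mul, ← sum_const]
    exact sum_le_sum fun π _ => hπ π
  have hr0 : (2 : ℝ) ≤ r := by exact_mod_cast hr2
  have hn0 : (0 : ℝ) < n := by have : 0 < n := by omega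
                               exact_mod_cast this
  have hd0 : (3 : ℝ) ≤ d := by exact_mod_cast hd
  have hB : (B : ℝ) ≤ 2 * n / (d + 1) := by
    have h6 : ((n / (d + 1) : ℕ) : ℝ) ≤ n / ((d + 1 : ℕ) : ℝ) := Nat.cast_div_le
    have h7 : (1 : ℝ) ≤ n / ((d + 1 : ℕ) : ℝ) := by
      rw [one_le_div (by positivity)]
      exact_mod_cast hdn
    push_cast at h6 h7
    simp only [B]
    push_cast
    rw [mul_div_assoc]
    linarith
  have hrB : ((d : ℝ) + 1) / 4 ≤ r * (1 / B) := by
    have hB0 : (0 : ℝ) < B := by positivity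
    rw [mul_one_div, le_div_iff₀ hB0]
    have h8 : (n : ℝ) ≤ 2 * r := by
      have : n ≤ 2 * r := by omega
      exact_mod_cast this
    calc ((d : ℝ) + 1) / 4 * B ≤ (d + 1) / 4 * (2 * n / (d + 1)) := by gcongr
      _ = n / 2 := by field_simp; norm_num
      _ ≤ r := by linarith
  -- Since `r / B ≥ (d + 1) / 4`, the left side is at most `(r - 1) - (d - 3) / 4`: the `3` is the
  -- cost of having `r * (r - 1)` rather than `r ^ 2` pairs.
  have h9 : (r : ℝ) * (1 - 1 / B) ≤ (r - 1) * (1 - (d - 3) / (4 * n)) := by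
    have h10 : ((r : ℝ) - 1) * ((d - 3) / (4 * n)) ≤ (d - 3) / 4 := by
      rw [mul_div_assoc', div_le_div_iff₀ (by positivity) (by norm_num)]
      have : (r : ℝ) - 1 ≤ n := by
        have : (r : ℝ) ≤ n := by exact_mod_cast hrn
        linarith
      have := mul_le_mul_of_nonneg_right this (by linarith : (0 : ℝ) ≤ (d - 3) * 4)
      linarith
    linarith
  have h11 : (r : ℝ) * ((r - 1) * #(farPairs n d (j + 1))) ≤
      r * ((r - 1) * ((1 - (d - 3) / (4 * n)) * #(farPairs n d j))) := by
    refine h4.trans ?_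
    have := mul_le_mul_of_nonneg_left h9
      (by positivity : (0 : ℝ) ≤ r * #(farPairs n d j))
    linarith
  exact le_of_mul_le_mul_left (le_of_mul_le_mul_left h11 (by linarith)) (by linarith)

theorem card_farPairs_le {n d j : ℕ} (hd : 3 ≤ d) (hdn : d + 1 ≤ n) (hj : 4 * j ≤ n) :
    (#(farPairs n d j) : ℝ) ≤ (1 - (d - 3) / (4 * n)) ^ j * n.factorial := by
  induction j with
  | zero =>
    rw [pow_zero, one_mul]
    have := card_le_univ (farPairs n d 0)
    rw [Fintype.card_perm, Fintype.card_fin] at this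
    exact_mod_cast this
  | succ j ih =>
    have h0 : (0 : ℝ) ≤ 1 - (d - 3) / (4 * n) := by
      have h1 : (d : ℝ) + 1 ≤ n := by exact_mod_cast hdn
      have h2 : (0 : ℝ) ≤ d := by positivity
      rw [sub_nonneg, div_le_one (by linarith)]
      linarith
    calc (#(farPairs n d (j + 1)) : ℝ)
        ≤ (1 - (d - 3) / (4 * n)) * #(farPairs n d j) := card_farPairs_succ_le hd hdn hj
      _ ≤ (1 - (d - 3) / (4 * n)) * ((1 - (d - 3) / (4 * n)) ^ j * n.factorial) := by
          gcongr
          exact ih (by omega)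
      _ = _ := by ring

theorem noSmallJumpProb_nonneg (d m : ℕ) : 0 ≤ noSmallJumpProb d m := by
  unfold noSmallJumpProb; positivity

theorem noSmallJumpProb_le_one (d m : ℕ) : noSmallJumpProb d m ≤ 1 := by
  unfold noSmallJumpProb
  rw [div_le_one (by positivity)]
  have := card_le_univ ({π | smallJumps d π = ∅} : Finset (Equiv.Perm (Fin (m + 1))))
  rw [Fintype.card_perm, Fintype.card_fin] at this
  exact_mod_cast this

theorem noSmallJumpProb_eq_zero {d m : ℕ} (hm : 1 ≤ m) (h : m ≤ d) : noSmallJumpProb d m = 0 := by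
  unfold noSmallJumpProb
  rw [div_eq_zero_iff]
  left
  rw [Nat.cast_eq_zero, card_eq_zero, filter_eq_empty_iff]
  intro π _ hπ
  have : (⟨0, hm⟩ : Fin m) ∈ smallJumps d π := by
    simp only [smallJumps, mem_filter, mem_univ, true_and]
    constructor <;> omega
  rw [hπ] at this
  exact notMem_empty _ this

theorem noSmallJumpProb_le_exp {d m : ℕ} (hm : 1 ≤ m) :
    noSmallJumpProb d m ≤ Real.exp (-((d : ℝ) - 3) / 32) := by
  rcases lt_or_ge d 3 with hd | hd
  · refine (noSmallJumpProb_le_one d m).trans (Real.one_le_exp ?_)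
    have : (d : ℝ) ≤ 3 := by exact_mod_cast hd.le
    linarith
  rcases le_or_gt m d with hdm | hdm
  · rw [noSmallJumpProb_eq_zero hm hdm]
    exact (Real.exp_pos _).le
  have hd0 : (3 : ℝ) ≤ d := by exact_mod_cast hd
  set j := (m + 1) / 4
  have h1 : #{π : Equiv.Perm (Fin (m + 1)) | smallJumps d π = ∅} ≤ #(farPairs (m + 1) d j) := by
    refine card_le_card fun π => ?_
    simp only [farPairs, mem_filter, mem_univ, true_and, smallJumps, filter_eq_empty_iff]
    intro H x y i _ hx hy
    have hy' := y.isLt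
    have hi : 2 * i < m := by omega
    have e1 : x = (⟨2 * i, hi⟩ : Fin m).castSucc := Fin.ext hx
    have e2 : y = (⟨2 * i, hi⟩ : Fin m).succ := Fin.ext hy
    rw [e1, e2]
    exact H trivial
  have h2 := card_farPairs_le (n := m + 1) (d := d) (j := j) hd (by omega) (by omega)
  have h3 : noSmallJumpProb d m ≤ (1 - (d - 3) / (4 * (m + 1 : ℕ))) ^ j := by
    unfold noSmallJumpProb
    rw [div_le_iff₀ (by positivity)]
    exact (Nat.cast_le.2 h1).trans h2
  refine h3.trans ?_
  have h0 : (0 : ℝ) ≤ 1 - (d - 3) / (4 * (m + 1 : ℕ)) := by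
    have : (d : ℝ) ≤ (m + 1 : ℕ) := by exact_mod_cast (by omega : d ≤ m + 1)
    rw [sub_nonneg, div_le_one (by positivity)]
    linarith
  calc (1 - ((d : ℝ) - 3) / (4 * (m + 1 : ℕ))) ^ j
      ≤ Real.exp (-(((d : ℝ) - 3) / (4 * (m + 1 : ℕ)))) ^ j := by
        gcongr
        linarith [Real.add_one_le_exp (-(((d : ℝ) - 3) / (4 * (m + 1 : ℕ))))]
    _ = Real.exp (-((d : ℝ) - 3) * (j / (4 * (m + 1 : ℕ)))) := by
        rw [← Real.exp_nat_mul]; congr 1; ring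
    _ ≤ _ := by
        rw [Real.exp_le_exp, div_eq_mul_one_div _ (32 : ℝ)]
        refine mul_le_mul_of_nonpos_left ?_ (by linarith)
        rw [div_le_div_iff₀ (by norm_num) (by positivity)]
        -- Here `m > d ≥ 3`, so `j ≥ 1` and the rounding in `(m + 1) / 4` loses at most a factor
        -- `2`; hence `32 = 4 * 8`.
        have : (m + 1 : ℕ) ≤ 8 * j := by omega
        have : ((m + 1 : ℕ) : ℝ) ≤ 8 * j := by exact_mod_cast this
        linarith

end MinJump

namespace MinJump

open Finset

/-! ### Moments as sums of tail probabilities -/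

/-- The increment of `x ↦ x ^ a` from `d` to `d + 1`. -/
def powIncrement (a d : ℕ) : ℝ := ((d : ℝ) + 1) ^ a - (d : ℝ) ^ a

theorem powIncrement_nonneg (a d : ℕ) : 0 ≤ powIncrement a d :=
  sub_nonneg.2 (pow_le_pow_left₀ (by positivity) (by linarith) a)

theorem powIncrement_le (a d : ℕ) : powIncrement a d ≤ ((d : ℝ) + 1) ^ a :=
  sub_le_self _ (by positivity)

/-- A telescoping sum. The term `0 ^ a` matters only for `a = 0`, where it equals `1`. -/
theorem hasSum_powIncrement_ite (a z : ℕ) :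
    HasSum (fun d : ℕ => powIncrement a d * if d + 1 ≤ z then 1 else 0) ((z : ℝ) ^ a - 0 ^ a) := by
  have h := hasSum_sum_of_ne_finset_zero (f := fun d : ℕ => powIncrement a d *
    if d + 1 ≤ z then 1 else 0) (s := range z) (L := SummationFilter.unconditional ℕ) (fun d hd => by
      rw [mem_range] at hd
      rw [if_neg (by omega), mul_zero])
  convert h using 1
  have h2 := sum_range_sub (fun d : ℕ => (d : ℝ) ^ a) z
  rw [Nat.cast_zero] at h2
  rw [← h2]
  refine sum_congr rfl fun d hd => ?_
  rw [mem_range] at hd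
  rw [if_pos (by omega), mul_one, powIncrement]
  push_cast
  rfl

theorem summable_powIncrement_mul_exp (a : ℕ) {r : ℝ} (hr : 0 < r) :
    Summable fun d : ℕ => powIncrement a d * Real.exp (-r * d) := by
  have h := (summable_nat_add_iff 1).2 (Real.summable_pow_mul_exp_neg_nat_mul a hr)
  refine Summable.of_nonneg_of_le
    (fun d => mul_nonneg (powIncrement_nonneg a d) (Real.exp_pos _).le) (fun d => ?_)
    (h.mul_left (Real.exp r))
  calc powIncrement a d * Real.exp (-r * d) ≤ ((d : ℝ) + 1) ^ a * Real.exp (-r * d) :=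
        mul_le_mul_of_nonneg_right (powIncrement_le a d) (Real.exp_pos _).le
    _ = Real.exp r * (((d + 1 : ℕ) : ℝ) ^ a * Real.exp (-r * (d + 1 : ℕ))) := by
        push_cast
        rw [mul_left_comm, ← Real.exp_add]
        ring_nf

/-- For `m = 0` this fails: there are no jumps, yet `sInf ∅ = 0`. -/
theorem succ_le_minJump_iff {m d : ℕ} (hm : 1 ≤ m) (π : Equiv.Perm (Fin (m + 1))) :
    d + 1 ≤ minJump π ↔ smallJumps d π = ∅ := by
  have hiff : ∀ x y : Fin (m + 1),
      ¬ Near d x y ↔ d + 1 ≤ (((y : ℕ) : ℤ) - ((x : ℕ) : ℤ)).natAbs := by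
    intro x y
    unfold Near
    omega
  simp only [smallJumps, filter_eq_empty_iff, mem_univ, true_implies, hiff]
  constructor
  · intro h i
    exact h.trans (Nat.sInf_le ⟨i.castSucc, i.succ, by simp, rfl⟩)
  · intro h
    refine le_csInf ⟨_, (⟨0, hm⟩ : Fin m).castSucc, (⟨0, hm⟩ : Fin m).succ, by simp, rfl⟩ ?_
    rintro _ ⟨i, j, hij, rfl⟩
    have hj := j.isLt
    have hi : (i : ℕ) < m := by omega
    have e1 : i = (⟨i, hi⟩ : Fin m).castSucc := Fin.ext rfl
    have e2 : j = (⟨i, hi⟩ : Fin m).succ := Fin.ext hij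
    have := @h ⟨i, hi⟩
    rwa [← e1, ← e2] at this

theorem hasSum_minJumpMoment {m : ℕ} (hm : 1 ≤ m) (a : ℕ) :
    HasSum (fun d : ℕ => powIncrement a d * noSmallJumpProb d m)
      (minJumpMoment (m + 1) a - 0 ^ a) := by
  have h := (hasSum_sum (s := (univ : Finset (Equiv.Perm (Fin (m + 1)))))
    fun π _ => hasSum_powIncrement_ite a (minJump π)).div_const ((m + 1).factorial : ℝ)
  have e1 : (fun d : ℕ => powIncrement a d * noSmallJumpProb d m) = fun d : ℕ =>
      (∑ π : Equiv.Perm (Fin (m + 1)), powIncrement a d * if d + 1 ≤ minJump π then 1 else 0) /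
        (m + 1).factorial := by
    funext d
    rw [← mul_sum, mul_div_assoc, noSmallJumpProb, card_filter]
    simp only [succ_le_minJump_iff hm]
    push_cast
    rfl
  have e2 : minJumpMoment (m + 1) a - 0 ^ a =
      (∑ π : Equiv.Perm (Fin (m + 1)), ((minJump π : ℝ) ^ a - 0 ^ a)) / (m + 1).factorial := by
    rw [minJumpMoment, expect_eq_sum_div_card, sum_sub_distrib, sub_div, sum_const, card_univ,
      Fintype.card_perm, Fintype.card_fin, nsmul_eq_mul,
      mul_div_cancel_left₀ _ (by positivity)]
  rw [e1, e2]
  exact h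

/-- Dominated convergence for series, with the bound of `noSmallJumpProb_le_exp`, which does not
depend on `m`. -/
theorem tendsto_minJumpMoment (a : ℕ) :
    Tendsto (fun n : ℕ => minJumpMoment n a) atTop
      (𝓝 (0 ^ a + ∑' d : ℕ, powIncrement a d * Real.exp (-2 * d))) := by
  rw [← tendsto_add_atTop_iff_nat 1]
  have hbound : Summable fun d : ℕ => powIncrement a d * Real.exp (-((d : ℝ) - 3) / 32) := by
    refine ((summable_powIncrement_mul_exp a (by norm_num : (0 : ℝ) < 1 / 32)).mul_left
      (Real.exp (3 / 32))).congr fun d => ?_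
    rw [mul_left_comm, ← Real.exp_add]
    ring_nf
  have h := tendsto_tsum_of_dominated_convergence (𝓕 := atTop)
    (f := fun m d => powIncrement a d * noSmallJumpProb d m) hbound
    (fun d => (tendsto_noSmallJumpProb d).const_mul (powIncrement a d)) (by
      filter_upwards [eventually_ge_atTop 1] with m hm d
      rw [Real.norm_of_nonneg (mul_nonneg (powIncrement_nonneg a d) (noSmallJumpProb_nonneg d m))]
      exact mul_le_mul_of_nonneg_left (noSmallJumpProb_le_exp hm) (powIncrement_nonneg a d))
  refine (h.const_add (0 ^ a)).congr' ?_
  filter_upwards [eventually_ge_atTop 1] with m hm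
  rw [(hasSum_minJumpMoment hm a).tsum_eq]
  ring

theorem integrable_pow_and_integral_eq {Ω : Type*} [MeasurableSpace Ω] {μ : Measure Ω} {Z : Ω → ℤ}
    (h : IsJumpLimit μ Z) (a : ℕ) :
    Integrable (fun ω => (Z ω : ℝ) ^ a) μ ∧
      ∫ ω, (Z ω : ℝ) ^ a ∂μ = 0 ^ a + ∑' d : ℕ, powIncrement a d * Real.exp (-2 * d) := by
  have := h.isProbabilityMeasure
  set E : ℕ → Set Ω := fun d => {ω | (d : ℤ) + 1 ≤ Z ω}
  have hE : ∀ d, MeasurableSet (E d) := fun d => measurableSet_le measurable_const h.measurable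
  set F : ℕ → Ω → ℝ := fun d => (E d).indicator fun _ => powIncrement a d
  have hF0 : ∀ d ω, 0 ≤ F d ω := fun d ω =>
    Set.indicator_nonneg (fun _ _ => powIncrement_nonneg a d) ω
  have hFint : ∀ d, Integrable (F d) μ := fun d => (integrable_const _).indicator (hE d)
  have hF : ∀ d, ∫ ω, F d ω ∂μ = powIncrement a d * Real.exp (-2 * d) := fun d => by
    rw [integral_indicator_const _ (hE d), h.tail d, smul_eq_mul, mul_comm]
  have hsum : Summable fun d : ℕ => powIncrement a d * Real.exp (-2 * d) :=
    summable_powIncrement_mul_exp a two_pos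
  -- The tail at `d = 0` is `exp 0 = 1`, so `Z` is almost surely positive and `Int.toNat` loses
  -- nothing.
  have hpos : ∀ᵐ ω ∂μ, 1 ≤ Z ω := by
    have h0 := h.tail 0
    simp only [Nat.cast_zero, zero_add, mul_zero, Real.exp_zero, measureReal_def,
      ENNReal.toReal_eq_one_iff] at h0
    exact (mem_ae_iff_prob_eq_one (measurableSet_le measurable_const h.measurable)).2 h0
  have hpt : ∀ᵐ ω ∂μ, HasSum (fun d => F d ω) ((Z ω : ℝ) ^ a - 0 ^ a) := by
    filter_upwards [hpos] with ω hω
    have hz : ((Z ω).toNat : ℤ) = Z ω := Int.toNat_of_nonneg (by omega)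
    have hz' : ((Z ω).toNat : ℝ) = (Z ω : ℝ) := by exact_mod_cast congrArg (Int.cast (R := ℝ)) hz
    rw [← hz']
    refine (hasSum_powIncrement_ite a (Z ω).toNat).congr_fun fun d => ?_
    have hiff : ω ∈ E d ↔ d + 1 ≤ (Z ω).toNat := by
      simp only [E, Set.mem_ofPred_eq]
      omega
    simp only [F, Set.indicator_apply, hiff, mul_ite, mul_one, mul_zero]
  have hmeas : Measurable fun ω => (Z ω : ℝ) ^ a - 0 ^ a :=
    ((measurable_of_countable (fun z : ℤ => (z : ℝ) ^ a - 0 ^ a)).comp h.measurable)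
  -- Tonelli turns the integral into the convergent tail series.
  have hlin : ∫⁻ ω, ‖(Z ω : ℝ) ^ a - 0 ^ a‖ₑ ∂μ < ⊤ := by
    have h1 : ∫⁻ ω, ‖(Z ω : ℝ) ^ a - 0 ^ a‖ₑ ∂μ = ∫⁻ ω, ∑' d, ENNReal.ofReal (F d ω) ∂μ := by
      refine lintegral_congr_ae (hpt.mono fun ω hω => ?_)
      simp only
      rw [← ENNReal.ofReal_tsum_of_nonneg (fun d => hF0 d ω) hω.summable, hω.tsum_eq,
        Real.enorm_of_nonneg (hω.nonneg fun d => hF0 d ω)]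
    rw [h1, lintegral_tsum fun d => (hFint d).aestronglyMeasurable.aemeasurable.ennreal_ofReal]
    simp only [← ofReal_integral_eq_lintegral_ofReal (hFint _) (ae_of_all _ (hF0 _)), hF]
    rw [← ENNReal.ofReal_tsum_of_nonneg
      (fun d => mul_nonneg (powIncrement_nonneg a d) (Real.exp_pos _).le) hsum]
    exact ENNReal.ofReal_lt_top
  have hint : Integrable (fun ω => (Z ω : ℝ) ^ a - 0 ^ a) μ := ⟨hmeas.aestronglyMeasurable, hlin⟩
  have hint' : Integrable (fun ω => (Z ω : ℝ) ^ a) μ := by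
    refine (hint.add (integrable_const ((0 : ℝ) ^ a))).congr (ae_of_all _ fun ω => ?_)
    simp
  refine ⟨hint', ?_⟩
  have hS := hasSum_integral_of_summable_integral_norm hFint (by
    refine hsum.congr fun d => ?_
    rw [← hF d]
    simp only [Real.norm_of_nonneg (hF0 d _)])
  have h1 : ∫ ω, ∑' d, F d ω ∂μ = ∫ ω, ((Z ω : ℝ) ^ a - 0 ^ a) ∂μ :=
    integral_congr_ae (hpt.mono fun ω hω => hω.tsum_eq)
  rw [h1, integral_sub hint' (integrable_const _)] at hS
  simp only [hF, integral_const, probReal_univ, one_smul] at hS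
  rw [hS.tsum_eq]
  ring

/-! ### The limit of the mean -/

/-- The ratio is written as `exp (-1) ^ 2` because `Real.exp_bound` needs an argument of absolute
value at most `1`. -/
theorem tsum_exp_neg_two_mul :
    ∑' d : ℕ, Real.exp (-2 * (d : ℝ)) = 1 / (1 - Real.exp (-1) ^ 2) := by
  rw [one_div, ← tsum_geometric_of_lt_one (by positivity)]
  · refine tsum_congr fun d => ?_
    rw [← Real.exp_nat_mul, ← Real.exp_nat_mul]
    congr 1
    push_cast
    ring
  · rw [← Real.exp_nat_mul, Real.exp_lt_one_iff]
    norm_num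

theorem abs_tsum_exp_neg_two_mul_sub_le :
    |(∑' d : ℕ, Real.exp (-2 * (d : ℝ))) - 1.1565176427496656518| ≤ 1 / (2 * 10 ^ 19) := by
  rw [tsum_exp_neg_two_mul]
  -- With `24` terms the remainder is below `2e-24`, enough to locate `exp (-1)` in an interval of
  -- length `1e-22`; `x ↦ 1 / (1 - x ^ 2)` has slope about `1` there.
  have h := Real.exp_bound (x := -1) (by norm_num) (n := 24) (by norm_num)
  norm_num [Finset.sum_range_succ, Nat.factorial] at h
  rw [abs_le] at h
  set x := Real.exp (-1)
  have hlo : (0.3678794411714423215955 : ℝ) ≤ x := by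
    refine le_trans ?_ (sub_le_iff_le_add.2 (neg_le_sub_iff_le_add.1 h.1))
    norm_num
  have hhi : x ≤ (0.3678794411714423215956 : ℝ) := by
    refine le_trans (sub_le_iff_le_add.1 h.2) ?_
    norm_num
  have hlo2 : (0.3678794411714423215955 : ℝ) ^ 2 ≤ x ^ 2 := by gcongr
  have hhi2 : x ^ 2 ≤ (0.3678794411714423215956 : ℝ) ^ 2 := by gcongr
  have hpos : 0 < 1 - x ^ 2 := by
    refine sub_pos.2 (hhi2.trans_lt ?_)
    norm_num
  rw [abs_le, neg_le_sub_iff_le_add, sub_le_iff_le_add]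
  constructor
  · rw [← sub_le_iff_le_add, le_div_iff₀ hpos]
    norm_num at hlo2 hhi2 ⊢
    linarith
  · rw [div_le_iff₀ hpos]
    norm_num at hlo2 hhi2 ⊢
    linarith

end MinJump

open MinJump in
theorem theorem4 :
    -- the moments converge to those of `Z`, which are finite
    (∀ (a : ℕ) (Ω : Type*) [MeasurableSpace Ω] (μ : Measure Ω) (Z : Ω → ℤ), IsJumpLimit μ Z →
      Integrable (fun ω => (Z ω : ℝ) ^ a) μ ∧
      Tendsto (fun n : ℕ => minJumpMoment n a) atTop (𝓝 (∫ ω, (Z ω : ℝ) ^ a ∂μ))) ∧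
    -- the expected minimum jump converges to `∑ exp (-2 d)`
    Summable (fun d : ℕ => Real.exp (-2 * (d : ℝ))) ∧
    Tendsto
      (fun n : ℕ =>
        Finset.expect (Finset.univ : Finset (Equiv.Perm (Fin n))) (fun π => (minJump π : ℝ)))
      atTop (𝓝 (∑' d : ℕ, Real.exp (-2 * (d : ℝ)))) ∧
    -- the numerical value, correct to the nearest unit in the nineteenth decimal place
    |(∑' d : ℕ, Real.exp (-2 * (d : ℝ))) - 1.1565176427496656518| ≤ 1 / (2 * 10 ^ 19) := by
  have hsum : Summable fun d : ℕ => Real.exp (-2 * (d : ℝ)) := by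
    -- For `a = 1` all increments equal `1`.
    simpa [powIncrement] using summable_powIncrement_mul_exp 1 two_pos
  refine ⟨fun a Ω _ μ Z h => ?_, hsum, ?_, abs_tsum_exp_neg_two_mul_sub_le⟩
  · obtain ⟨h1, h2⟩ := integrable_pow_and_integral_eq h a
    exact ⟨h1, h2 ▸ tendsto_minJumpMoment a⟩
  · simpa [minJumpMoment, powIncrement] using tendsto_minJumpMoment 1
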